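/- Let $\mathbf D=(D;\sqcap,\sqcup,\neg,\lrcorner,\top,\bot)$ be a double Boolean algebra (dBa), i.e. an algebra satisfying, for all $x,y,z\in D$, with $x\vee y:=\neg(\neg x\sqcap\neg y)$ and $x\wedge y:=\lrcorner(\lrcorner x\sqcup\lrcorner y)$, $(x\sqcap x)\sqcap y=x\sqcap y$; $x\sqcap y=y\sqcap x$; $\neg(x\sqcap x)=\neg x$; $x\sqcap(x\sqcup y)=x\sqcap x$; $x\sqcap(y\vee z)=(x\sqcap y)\vee(x\sqcap z)$; $x\sqcap(x\vee y)=x\sqcap x$; $\neg\neg(x\sqcap y)=x\sqcap y$; $x\sqcap\neg x=\bot$; $\neg\top=\bot$; $x\sqcap(y\sqcap z)=(x\sqcap y)\sqcap z$; $\neg\bot=\top\sqcap\top$; the identities obtained from these by interchanging $\sqcap,\vee,\neg,\top$ with $\sqcup,\wedge,\lrcorner,\bot$; and $(x\sqcap x)\sqcup(x\sqcap x)=(x\sqcup x)\sqcap(x\sqcup x)$. Put $x\sqsubseteq y$ iff $x\sqcap y=x\sqcap x$ and $x\sqcup y=y\sqcup y$. $\mathbf D$ is contextual if $\sqsubseteq$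 is a partial order; fully contextual if it is contextual and for all $y,x\in D$ with $y\sqcap y=y$, $x\sqcup x=x$ and $y\sqcup y=x\sqcap x$ there is a unique $z\in D$ with $z\sqcap z=y$ and $z\sqcup z=x$; and pure if every $x\in D$ satisfies $x\sqcap x=x$ or $x\sqcup x=x$. A filter (resp. ideal) of $\mathbf D$ is a subset of $D$ closed under $\sqcap$ and upward closed for $\sqsubseteq$ (resp. closed under $\sqcup$ and downward closed). A primary filter (resp. ideal) is a nonempty proper filter (resp. ideal) containing $x$ or $\neg x$ (resp. $x$ or $\lrcorner x$) for every $x\in D$. Let $\mathcal F_{pr}(\mathbf D)$ and $\mathcal I_{pr}(\mathbf D)$ be the sets of primary filters and of primary ideals, $F_x:=\{F\in\mathcal F_{pr}(\mathbf D)\mid x\in F\}$ and $I_x:=\{I\in\mathcal I_{pr}(\mathbf D)\mid x\in I\}$ for $x \in D$. Give $\mathcal F_{pr}(\mathbf D)$ (resp. $\mathcal I_{pr}(\mathbf D)$) the topology with the sets $F_x$ (resp. $I_x$), $x\in D$, as a subbase for the closed sets. Let $F\mathrel\Delta I$ iff $F\cap I\ne\emptyset$, and let $\mathbb K^T(\mathbf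 D)$ be the context $(\mathcal F_{pr}(\mathbf D),\mathcal I_{pr}(\mathbf D),\Delta)$ with these topologies. For a context $(G,M,R)$, $A\subseteq G$ and $B\subseteq M$, let $A':=\{m\in M\mid gRm\ \forall g\in A\}$ and $B':=\{g\in G\mid gRm\ \forall m\in B\}$. The pair $(A,B)$ is a protoconcept if $A''=B'$, and a semiconcept if $A'=B$ or $B'=A$; it is called clopen if $A$ and $B$ are clopen. The operations on such pairs are $(A,B)\sqcap(C,D)=(A\cap C,(A\cap C)')$, $(A,B)\sqcup(C,D)=((B\cap D)',B\cap D)$, $\neg(A,B)=(G\setminus A,(G\setminus A)')$, $\lrcorner(A,B)=((M\setminus B)',M\setminus B)$, $\top=(G,\emptyset)$, $\bot=(\emptyset,M)$. 1. Suppose $\mathbf D$ is fully contextual. Then for all $A\subseteq\mathcal F_{pr}(\mathbf D)$ and $B\subseteq\mathcal I_{pr}(\mathbf D)$, $(A,B)$ is a clopen protoconcept of $\mathbb K^T(\mathbf D)$ if and only if $A=F_x$ and $B=I_x$ for some $x\in D$. Moreover, the set of clopen protoconcepts of $\mathbb K^T(\mathbf D)$ is closed under the operations above and forms with them a fully contextual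 dBa, and $x\mapsto(F_x,I_x)$ is an isomorphism from $\mathbf D$ onto it. 2. Suppose $\mathbf D$ is pure. Then for all $A\subseteq\mathcal F_{pr}(\mathbf D)$ and $B\subseteq\mathcal I_{pr}(\mathbf D)$, $(A,B)$ is a clopen semiconcept of $\mathbb K^T(\mathbf D)$ if and only if $A=F_x$ and $B=I_x$ for some $x\in D$. Moreover, the set of clopen semiconcepts of $\mathbb K^T(\mathbf D)$ is closed under the operations above and forms with them a pure dBa, and $x\mapsto(F_x,I_x)$ is an isomorphism from $\mathbf D$ onto it. -/

import Mathlib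

/-- Algebras of type `(2,2,1,1,0,0)`: two binary operations (meet and join), two unary operations
(negation and opposition) and two constants (top and bottom). -/
class DBOps (D : Type*) where
  meet : D → D → D
  join : D → D → D
  neg : D → D
  opp : D → D
  top : D
  bot : D

namespace DBOps

infixl:69 " ⊓ₔ " => DBOps.meet
infixl:68 " ⊔ₔ " => DBOps.join

variable {D : Type*} [DBOps D]

/-- The derived operation `x ∨ y = ¬(¬x ⊓ ¬y)`. -/
def vee (x y : D) : D := neg (neg x ⊓ₔ neg y)

/-- The derived operation `x ∧ y = ⌟(⌟x ⊔ ⌟y)`. -/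
def wedge (x y : D) : D := opp (opp x ⊔ₔ opp y)

/-- The quasi-order `x ⊑ y` of a double Boolean algebra. -/
def le (x y : D) : Prop := x ⊓ₔ y = x ⊓ₔ x ∧ x ⊔ₔ y = y ⊔ₔ y

end DBOps

open DBOps in
/-- Double Boolean algebras, by the identities of Wille. -/
class DoubleBooleanAlgebra (D : Type*) [DBOps D] : Prop where
  ax1a : ∀ x y : D, (x ⊓ₔ x) ⊓ₔ y = x ⊓ₔ y
  ax1b : ∀ x y : D, (x ⊔ₔ x) ⊔ₔ y = x ⊔ₔ y
  ax2a : ∀ x y : D, x ⊓ₔ y = y ⊓ₔ x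
  ax2b : ∀ x y : D, x ⊔ₔ y = y ⊔ₔ x
  ax3a : ∀ x : D, neg (x ⊓ₔ x) = neg x
  ax3b : ∀ x : D, opp (x ⊔ₔ x) = opp x
  ax4a : ∀ x y : D, x ⊓ₔ (x ⊔ₔ y) = x ⊓ₔ x
  ax4b : ∀ x y : D, x ⊔ₔ (x ⊓ₔ y) = x ⊔ₔ x
  ax5a : ∀ x y z : D, x ⊓ₔ vee y z = vee (x ⊓ₔ y) (x ⊓ₔ z)
  ax5b : ∀ x y z : D, x ⊔ₔ wedge y z = wedge (x ⊔ₔ y) (x ⊔ₔ z)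
  ax6a : ∀ x y : D, x ⊓ₔ vee x y = x ⊓ₔ x
  ax6b : ∀ x y : D, x ⊔ₔ wedge x y = x ⊔ₔ x
  ax7a : ∀ x y : D, neg (neg (x ⊓ₔ y)) = x ⊓ₔ y
  ax7b : ∀ x y : D, opp (opp (x ⊔ₔ y)) = x ⊔ₔ y
  ax8a : ∀ x : D, x ⊓ₔ neg x = bot
  ax8b : ∀ x : D, x ⊔ₔ opp x = top
  ax9a : neg (top : D) = bot
  ax9b : opp (bot : D) = top
  ax10a : ∀ x y z : D, x ⊓ₔ (y ⊓ₔ z) = (x ⊓ₔ y) ⊓ₔ z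
  ax10b : ∀ x y z : D, x ⊔ₔ (y ⊔ₔ z) = (x ⊔ₔ y) ⊔ₔ z
  ax11a : neg (bot : D) = top ⊓ₔ top
  ax11b : opp (top : D) = bot ⊔ₔ bot
  ax12 : ∀ x : D, (x ⊓ₔ x) ⊔ₔ (x ⊓ₔ x) = (x ⊔ₔ x) ⊓ₔ (x ⊔ₔ x)

namespace DBOps

/-- Contextual: the quasi-order is an order. -/
def Contextual (D : Type*) [DBOps D] : Prop := IsPartialOrder D (le : D → D → Prop)

/-- Fully contextual: contextual, and every `y ∈ D_⊓` and `x ∈ D_⊔` with `y_⊔ = x_⊓` are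
`y = z_⊓` and `x = z_⊔` for a unique `z`. -/
def FullyContextual (D : Type*) [DBOps D] : Prop :=
  Contextual D ∧ ∀ y x : D, y ⊓ₔ y = y → x ⊔ₔ x = x → y ⊔ₔ y = x ⊓ₔ x →
    ∃! z : D, z ⊓ₔ z = y ∧ z ⊔ₔ z = x

/-- Pure: every element lies in `D_⊓` or in `D_⊔`. -/
def Pure (D : Type*) [DBOps D] : Prop := ∀ x : D, x ⊓ₔ x = x ∨ x ⊔ₔ x = x

/-- Isomorphisms of algebras of type `(2,2,1,1,0,0)`. -/
structure Iso (D E : Type*) [DBOps D] [DBOps E] extends D ≃ E where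
  map_meet : ∀ x y, toFun (x ⊓ₔ y) = toFun x ⊓ₔ toFun y
  map_join : ∀ x y, toFun (x ⊔ₔ y) = toFun x ⊔ₔ toFun y
  map_neg : ∀ x, toFun (neg x) = neg (toFun x)
  map_opp : ∀ x, toFun (opp x) = opp (toFun x)
  map_top : toFun top = top
  map_bot : toFun bot = bot

/-- Filters: closed under meet and upward closed for the quasi-order. -/
def IsFilter {D : Type*} [DBOps D] (F : Set D) : Prop :=
  (∀ x ∈ F, ∀ y ∈ F, x ⊓ₔ y ∈ F) ∧ ∀ x ∈ F, ∀ z, le x z → z ∈ F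

/-- Ideals: closed under join and downward closed for the quasi-order. -/
def IsIdeal {D : Type*} [DBOps D] (I : Set D) : Prop :=
  (∀ x ∈ I, ∀ y ∈ I, x ⊔ₔ y ∈ I) ∧ ∀ x ∈ I, ∀ z, le z x → z ∈ I

end DBOps

section Standard

open DBOps

/-- Primary filters: nonempty proper filters containing `x` or `¬x` for every `x`. -/
@[ext] structure PrimaryFilter (D : Type*) [DBOps D] where
  carrier : Set D
  isFilter : IsFilter carrier
  nonempty : carrier.Nonempty
  proper : carrier ≠ Set.univ
  primary : ∀ x, x ∈ carrier ∨ neg x ∈ carrier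

/-- Primary ideals: nonempty proper ideals containing `x` or `⌟x` for every `x`. -/
@[ext] structure PrimaryIdeal (D : Type*) [DBOps D] where
  carrier : Set D
  isIdeal : IsIdeal carrier
  nonempty : carrier.Nonempty
  proper : carrier ≠ Set.univ
  primary : ∀ x, x ∈ carrier ∨ opp x ∈ carrier

/-- `F_x`, the set of primary filters containing `x`. -/
def filtersAt {D : Type*} [DBOps D] (x : D) : Set (PrimaryFilter D) := {F | x ∈ F.carrier}

/-- `I_x`, the set of primary ideals containing `x`. -/
def idealsAt {D : Type*} [DBOps D] (x : D) : Set (PrimaryIdeal D) := {I | x ∈ I.carrier}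

/-- The topology with the sets `F_x` as a subbase for the closed sets. -/
instance PrimaryFilter.instTopologicalSpace (D : Type*) [DBOps D] :
    TopologicalSpace (PrimaryFilter D) :=
  TopologicalSpace.generateFrom {U | ∃ x : D, U = (filtersAt x)ᶜ}

/-- The topology with the sets `I_x` as a subbase for the closed sets. -/
instance PrimaryIdeal.instTopologicalSpace (D : Type*) [DBOps D] :
    TopologicalSpace (PrimaryIdeal D) :=
  TopologicalSpace.generateFrom {U | ∃ x : D, U = (idealsAt x)ᶜ}

/-- The relation `Δ`: the filter and the ideal meet. -/
def Delta (D : Type*) [DBOps D] (F : PrimaryFilter D) (I : PrimaryIdeal D) : Prop :=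
  (F.carrier ∩ I.carrier).Nonempty

end Standard

section Context

variable {G M : Type*} (R : G → M → Prop)

/-- `(A, B)` is a protoconcept of the context `(G, M, R)`: `A'' = B'`. -/
def IsProtoconcept (A : Set G) (B : Set M) : Prop :=
  lowerPolar R (upperPolar R A) = lowerPolar R B

/-- `(A, B)` is a semiconcept of the context `(G, M, R)`: `B = A'` or `A = B'`. -/
def IsSemiconcept (A : Set G) (B : Set M) : Prop :=
  upperPolar R A = B ∨ lowerPolar R B = A

/-- The set of clopen protoconcepts of a context on topological spaces. -/
def clopenProtoconcepts [TopologicalSpace G] [TopologicalSpace M] : Set (Set G × Set M) :=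
  {p | IsProtoconcept R p.1 p.2 ∧ IsClopen p.1 ∧ IsClopen p.2}

/-- The set of clopen semiconcepts of a context on topological spaces. -/
def clopenSemiconcepts [TopologicalSpace G] [TopologicalSpace M] : Set (Set G × Set M) :=
  {p | IsSemiconcept R p.1 p.2 ∧ IsClopen p.1 ∧ IsClopen p.2}

/-- `(A, B) ⊓ (C, D) = (A ∩ C, (A ∩ C)')`. -/
def pairMeet (p q : Set G × Set M) : Set G × Set M := (p.1 ∩ q.1, upperPolar R (p.1 ∩ q.1))

/-- `(A, B) ⊔ (C, D) = ((B ∩ D)', B ∩ D)`. -/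
def pairJoin (p q : Set G × Set M) : Set G × Set M := (lowerPolar R (p.2 ∩ q.2), p.2 ∩ q.2)

/-- `¬(A, B) = (G \ A, (G \ A)')`. -/
def pairNeg (p : Set G × Set M) : Set G × Set M := (p.1ᶜ, upperPolar R p.1ᶜ)

/-- `⌟(A, B) = ((M \ B)', M \ B)`. -/
def pairOpp (p : Set G × Set M) : Set G × Set M := (lowerPolar R p.2ᶜ, p.2ᶜ)

/-- The set `S` of pairs contains `(G, ∅)` and `(∅, M)` and is closed under the operations of the
algebra of protoconcepts. -/
structure ClosedUnderPairOps (S : Set (Set G × Set M)) : Prop where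
  meet_mem : ∀ p ∈ S, ∀ q ∈ S, pairMeet R p q ∈ S
  join_mem : ∀ p ∈ S, ∀ q ∈ S, pairJoin R p q ∈ S
  neg_mem : ∀ p ∈ S, pairNeg R p ∈ S
  opp_mem : ∀ p ∈ S, pairOpp R p ∈ S
  top_mem : ((Set.univ : Set G), (∅ : Set M)) ∈ S
  bot_mem : ((∅ : Set G), (Set.univ : Set M)) ∈ S

variable {R}

/-- A set of pairs closed under the operations of the algebra of protoconcepts, as an algebra under
the restricted operations. -/
@[reducible] def ClosedUnderPairOps.ops {S : Set (Set G × Set M)} (h : ClosedUnderPairOps R S) :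
    DBOps S where
  meet p q := ⟨pairMeet R p q, h.meet_mem p p.2 q q.2⟩
  join p q := ⟨pairJoin R p q, h.join_mem p p.2 q q.2⟩
  neg p := ⟨pairNeg R p, h.neg_mem p p.2⟩
  opp p := ⟨pairOpp R p, h.opp_mem p p.2⟩
  top := ⟨(Set.univ, ∅), h.top_mem⟩
  bot := ⟨(∅, Set.univ), h.bot_mem⟩

end Context

/-! This is Stone duality applied to two Boolean algebras inside `D`: the elements with `x ⊓ x = x`
(the meet part) and those with `x ⊔ x = x` (the join part). The prime ideal theorem in the meet part
separates elements by primary filters, so `F_x` determines `x ⊓ x`, and the clopen sets of primary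
filters are exactly the `F_a` with `a` in the meet part. Dually, `I_x` determines `x ⊔ x`, and the
clopen sets of primary ideals are the `I_b` with `b` in the join part.

The polars link the two sides: `F_a' = I_a` for `a` in the meet part (`upperPolar_filtersAt`) and
`I_b' = F_b` for `b` in the join part (`lowerPolar_idealsAt`). Hence `x ↦ (F_x, I_x)` respects all
operations. A clopen semiconcept is `(F_a, I_a)` or `(F_b, I_b)`, while `(F_a, I_b)` is a
protoconcept iff `a ⊔ a = b ⊓ b`, which is the situation in which full contextuality supplies `z`
with `z ⊓ z = a` and `z ⊔ z = b`.

The map is injective because `x ⊓ x` and `x ⊔ x` together determine `x` when `D` is contextual or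
pure. The identities and the extra properties then transfer along the isomorphism. -/

namespace DBOps

/-! ### The Boolean algebra of `⊓`-idempotents. -/

section MeetPart

variable {D : Type*} [DBOps D] [DoubleBooleanAlgebra D]

open DoubleBooleanAlgebra

theorem meet_meet_self (x y : D) : x ⊓ₔ (y ⊓ₔ y) = x ⊓ₔ y := by
  rw [ax2a, ax1a, ax2a]

theorem meet_idem (x y : D) : (x ⊓ₔ y) ⊓ₔ (x ⊓ₔ y) = x ⊓ₔ y := by
  rw [ax10a, ax2a (x ⊓ₔ y) x, ax10a, ax1a, ← ax10a, meet_meet_self]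

theorem join_idem (x y : D) : (x ⊔ₔ y) ⊔ₔ (x ⊔ₔ y) = x ⊔ₔ y := by
  rw [ax10b, ax2b (x ⊔ₔ y) x, ax10b, ax1b, ← ax10b, ax2b x (y ⊔ₔ y), ax1b, ax2b]

theorem neg_neg_eq (x : D) : neg (neg x) = x ⊓ₔ x := by
  rw [← ax7a, ax3a]

theorem neg_meet_neg (x : D) : neg x ⊓ₔ neg x = neg x := by
  rw [← neg_neg_eq, neg_neg_eq x, ax3a]

theorem opp_join_opp (x : D) : opp x ⊔ₔ opp x = opp x := by
  rw [← ax7b, ax3b, ← ax3b x, ax7b x x, ax3b]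

theorem bot_meet_bot : (bot : D) ⊓ₔ bot = bot := by
  rw [← ax8a (bot : D), meet_idem]

theorem meet_top (x : D) : x ⊓ₔ top = x ⊓ₔ x := by
  rw [← ax8b x, ax4a]

theorem bot_meet (x : D) : bot ⊓ₔ x = bot := by
  rw [← ax8a x, ax2a, ax10a, ax1a]

/-- The elements `x` with `x ⊓ x = x`. -/
def MeetPart (D : Type*) [DBOps D] : Type _ := {x : D // x ⊓ₔ x = x}

/-- The Boolean algebra of the elements `x` with `x ⊓ x = x`. -/
instance MeetPart.instLattice : Lattice (MeetPart D) where
  le x y := x.1 ⊓ₔ y.1 = x.1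
  le_refl x := x.2
  le_trans x y z hxy hyz := by
    rw [← hxy, ← ax10a, hyz]
  le_antisymm x y hxy hyx := Subtype.ext <| by
    rw [← hxy, ax2a, hyx]
  inf x y := ⟨x.1 ⊓ₔ y.1, meet_idem _ _⟩
  inf_le_left x y := by
    change (x.1 ⊓ₔ y.1) ⊓ₔ x.1 = x.1 ⊓ₔ y.1
    rw [ax2a, ax10a, x.2]
  inf_le_right x y := by
    change (x.1 ⊓ₔ y.1) ⊓ₔ y.1 = x.1 ⊓ₔ y.1
    rw [← ax10a, y.2]
  le_inf x y z hxy hxz := by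
    change x.1 ⊓ₔ (y.1 ⊓ₔ z.1) = x.1
    rw [ax10a, hxy, hxz]
  sup x y := ⟨vee x.1 y.1, neg_meet_neg _⟩
  le_sup_left x y := by
    change x.1 ⊓ₔ vee x.1 y.1 = x.1
    rw [ax6a, x.2]
  le_sup_right x y := by
    change y.1 ⊓ₔ vee x.1 y.1 = y.1
    rw [vee, ax2a (neg x.1)]
    exact (ax6a _ _).trans y.2
  sup_le x y z hxz hyz := by
    change vee x.1 y.1 ⊓ₔ z.1 = vee x.1 y.1
    rw [ax2a, ax5a, ax2a z.1, ax2a z.1, hxz, hyz]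

/-- The greatest element is `top ⊓ₔ top`, since `top` itself need not be `⊓`-idempotent. -/
instance MeetPart.instBooleanAlgebra : BooleanAlgebra (MeetPart D) where
  __ := DistribLattice.ofInfSupLe fun x y z : MeetPart D => by
    exact le_of_eq (Subtype.ext (ax5a x.1 y.1 z.1))
  compl x := ⟨neg x.1, neg_meet_neg _⟩
  top := ⟨top ⊓ₔ top, meet_idem _ _⟩
  bot := ⟨bot, bot_meet_bot⟩
  inf_compl_le_bot x := le_of_eq (Subtype.ext (ax8a x.1))
  top_le_sup_compl x := le_of_eq <| Subtype.ext <| by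
    change top ⊓ₔ top = neg (neg x.1 ⊓ₔ neg (neg x.1))
    rw [ax8a, ax11a]
  le_top x := by
    change x.1 ⊓ₔ (top ⊓ₔ top) = x.1
    rw [meet_meet_self, meet_top, x.2]
  bot_le x := bot_meet x.1

theorem MeetPart.le_iff {x y : MeetPart D} : x ≤ y ↔ x.1 ⊓ₔ y.1 = x.1 := Iff.rfl

/-- The element `x ⊓ x` of the meet part. -/
def meetSelf (x : D) : MeetPart D := ⟨x ⊓ₔ x, meet_idem x x⟩

theorem meetSelf_coe (x : MeetPart D) : meetSelf x.1 = x := Subtype.ext x.2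

theorem meetSelf_meet (x y : D) : meetSelf (x ⊓ₔ y) = meetSelf x ⊓ meetSelf y :=
  Subtype.ext <| by
    change (x ⊓ₔ y) ⊓ₔ (x ⊓ₔ y) = (x ⊓ₔ x) ⊓ₔ (y ⊓ₔ y)
    rw [meet_idem, meet_meet_self, ax1a]

theorem meetSelf_neg (x : D) : meetSelf (neg x) = (meetSelf x)ᶜ :=
  Subtype.ext <| by
    change neg x ⊓ₔ neg x = neg (x ⊓ₔ x)
    rw [neg_meet_neg, ax3a]

theorem meetSelf_mono {x y : D} (h : le x y) : meetSelf x ≤ meetSelf y := by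
  change (x ⊓ₔ x) ⊓ₔ (y ⊓ₔ y) = x ⊓ₔ x
  rw [meet_meet_self, ax1a, h.1]

theorem meetSelf_top : meetSelf (top : D) = ⊤ := rfl

theorem meet_le_left (x y : D) : le (x ⊓ₔ y) x :=
  ⟨by rw [meet_idem, ax2a, ax10a, ax1a], by rw [ax2b, ax4b]⟩

theorem MeetPart.coe_mono {x y : MeetPart D} (h : x ≤ y) : le x.1 y.1 := by
  rw [← MeetPart.le_iff.1 h, ax2a]
  exact meet_le_left _ _

/-- The trace on the meet part of an ideal. -/
def idealTrace (I : Set D) (hI : IsIdeal I) (hne : I.Nonempty) : Order.Ideal (MeetPart D) where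
  carrier := {x | x.1 ∈ I}
  lower' _ _ hba ha := hI.2 _ ha _ (MeetPart.coe_mono hba)
  nonempty' := by
    obtain ⟨x, hx⟩ := hne
    exact ⟨meetSelf x, hI.2 x hx _ (meet_le_left x x)⟩
  directed' x hx y hy := by
    -- The bound comes from the join of `D`, under which `I` is closed, and not from the supremum
    -- `vee` of the meet part.
    refine ⟨meetSelf (x.1 ⊔ₔ y.1), hI.2 _ (hI.1 _ hx _ hy) _ (meet_le_left _ _), ?_, ?_⟩
    · change x.1 ⊓ₔ ((x.1 ⊔ₔ y.1) ⊓ₔ (x.1 ⊔ₔ y.1)) = x.1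
      rw [meet_meet_self, ax4a, x.2]
    · change y.1 ⊓ₔ ((x.1 ⊔ₔ y.1) ⊓ₔ (x.1 ⊔ₔ y.1)) = y.1
      rw [meet_meet_self, ax2b, ax4a, y.2]

end MeetPart

end DBOps

open DBOps DoubleBooleanAlgebra

/-! ### Primary filters: separation, clopen sets and polars. -/

section Filters

variable {D : Type*} [DBOps D] [DoubleBooleanAlgebra D]

/-- The primary filter of the elements `x` with `x ⊓ x` outside a prime ideal of the meet part. -/
def PrimaryFilter.ofPrime (J : Order.Ideal (MeetPart D)) (hJ : J.IsPrime) : PrimaryFilter D where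
  carrier := {x | meetSelf x ∉ J}
  isFilter := by
    refine ⟨fun x hx y hy h => ?_, fun x hx z hxz h => hx (J.lower (meetSelf_mono hxz) h)⟩
    rw [meetSelf_meet] at h
    exact (hJ.mem_or_mem h).elim hx hy
  nonempty := ⟨top, hJ.toIsProper.top_notMem⟩
  proper h := by
    have : meetSelf (⊥ : MeetPart D).1 ∉ J := Set.eq_univ_iff_forall.1 h _
    rw [meetSelf_coe] at this
    exact this J.bot_mem
  primary x := by
    by_contra! h
    have h1 : meetSelf x ∈ J := not_not.1 h.1
    have h2 : meetSelf (neg x) ∈ J := not_not.1 h.2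
    rw [meetSelf_neg] at h2
    refine hJ.toIsProper.top_notMem ?_
    rw [← sup_compl_eq_top (x := meetSelf x)]
    exact Order.Ideal.sup_mem h1 h2

/-- The prime ideal theorem extends `J` to a prime ideal avoiding `a`; the primary filter is the
preimage of its complement under `x ↦ x ⊓ x`. -/
theorem PrimaryFilter.exists_of_notMem_ideal {a : MeetPart D} {J : Order.Ideal (MeetPart D)}
    (h : a ∉ J) : ∃ F : PrimaryFilter D, a.1 ∈ F.carrier ∧ ∀ b ∈ J, b.1 ∉ F.carrier := by
  obtain ⟨K, hK, hJK, hd⟩ := DistribLattice.prime_ideal_of_disjoint_filter_ideal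
    (F := Order.PFilter.principal a) (I := J) (Set.disjoint_left.2 fun x hx hxJ =>
      h (J.lower (Order.PFilter.mem_principal.1 hx) hxJ))
  refine ⟨PrimaryFilter.ofPrime K hK, ?_, fun b hb hbF => ?_⟩
  · change meetSelf a.1 ∉ K
    rw [meetSelf_coe]
    exact fun haK => Set.disjoint_left.1 hd (Order.PFilter.mem_principal.2 le_rfl) haK
  · refine (hbF : meetSelf b.1 ∉ K) ?_
    rw [meetSelf_coe]
    exact hJK hb

namespace PrimaryFilter

variable (F : PrimaryFilter D) {x y : D}

theorem meet_self_mem_iff : x ⊓ₔ x ∈ F.carrier ↔ x ∈ F.carrier :=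
  ⟨fun h => F.isFilter.2 _ h _ (meet_le_left x x), fun h => F.isFilter.1 _ h _ h⟩

theorem meet_mem_iff : x ⊓ₔ y ∈ F.carrier ↔ x ∈ F.carrier ∧ y ∈ F.carrier :=
  ⟨fun h => ⟨F.isFilter.2 _ h _ (meet_le_left x y),
    F.isFilter.2 _ h _ (by rw [ax2a]; exact meet_le_left y x)⟩, fun h => F.isFilter.1 _ h.1 _ h.2⟩

theorem mem_of_le {a b : MeetPart D} (h : a ≤ b) (ha : a.1 ∈ F.carrier) : b.1 ∈ F.carrier :=
  F.isFilter.2 _ ha _ (MeetPart.coe_mono h)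

theorem mem_of_meetSelf_le (h : meetSelf x ≤ meetSelf y) (hx : x ∈ F.carrier) :
    y ∈ F.carrier :=
  F.meet_self_mem_iff.1 (F.mem_of_le h (F.meet_self_mem_iff.2 hx))

theorem bot_notMem : (bot : D) ∉ F.carrier := fun h =>
  F.proper <| Set.eq_univ_of_forall fun y =>
    F.mem_of_meetSelf_le (x := bot) (by
      rw [show meetSelf (bot : D) = ⊥ from meetSelf_coe (⊥ : MeetPart D)]
      exact bot_le) h

theorem top_mem : (top : D) ∈ F.carrier := by
  obtain ⟨x, hx⟩ := F.nonempty
  refine F.mem_of_meetSelf_le (x := x) ?_ hx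
  rw [meetSelf_top]
  exact le_top

theorem neg_mem_iff : neg x ∈ F.carrier ↔ x ∉ F.carrier :=
  ⟨fun h hx => F.bot_notMem (by rw [← ax8a x]; exact F.isFilter.1 _ hx _ h),
    fun h => (F.primary x).resolve_left h⟩

end PrimaryFilter

theorem filtersAt_meet (x y : D) : filtersAt (x ⊓ₔ y) = filtersAt x ∩ filtersAt y :=
  Set.ext fun F => F.meet_mem_iff

theorem filtersAt_meet_self (x : D) : filtersAt (x ⊓ₔ x) = filtersAt x := by
  rw [filtersAt_meet, Set.inter_self]

theorem filtersAt_neg (x : D) : filtersAt (neg x) = (filtersAt x)ᶜ :=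
  Set.ext fun F => F.neg_mem_iff

theorem filtersAt_top : filtersAt (top : D) = Set.univ :=
  Set.eq_univ_of_forall PrimaryFilter.top_mem

theorem filtersAt_bot : filtersAt (bot : D) = ∅ :=
  Set.eq_empty_of_forall_notMem PrimaryFilter.bot_notMem

theorem meetSelf_le_of_filtersAt_subset {x y : D} (h : filtersAt x ⊆ filtersAt y) :
    meetSelf x ≤ meetSelf y := by
  by_contra hn
  obtain ⟨F, hx, hy⟩ := PrimaryFilter.exists_of_notMem_ideal
    (a := meetSelf x) (J := Order.Ideal.principal (meetSelf y))
    (fun hm => hn (Order.Ideal.mem_principal.1 hm))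
  exact hy _ (Order.Ideal.mem_principal.2 le_rfl)
    (F.meet_self_mem_iff.2 (h (F.meet_self_mem_iff.1 hx)))

theorem meet_self_eq_of_filtersAt_eq {x y : D} (h : filtersAt x = filtersAt y) :
    x ⊓ₔ x = y ⊓ₔ y :=
  congrArg (fun a : MeetPart D => a.1) (le_antisymm
    (meetSelf_le_of_filtersAt_subset h.subset)
    (meetSelf_le_of_filtersAt_subset h.superset))

theorem isClopen_filtersAt (x : D) : IsClopen (filtersAt x) := by
  refine ⟨⟨TopologicalSpace.isOpen_generateFrom_of_mem ⟨x, rfl⟩⟩, ?_⟩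
  refine TopologicalSpace.isOpen_generateFrom_of_mem ⟨neg x, ?_⟩
  rw [filtersAt_neg, compl_compl]

/-- The sets `F_a` form a base: the subbasic open set `F_xᶜ` is `F_{¬x}`, and `F_a ∩ F_b = F_{a ⊓
b}`. -/
theorem exists_filtersAt_subset_of_isOpen {U : Set (PrimaryFilter D)} (hU : IsOpen U)
    {F : PrimaryFilter D} (hF : F ∈ U) : ∃ a : D, F ∈ filtersAt a ∧ filtersAt a ⊆ U := by
  induction hU with
  | basic V hV =>
    obtain ⟨x, rfl⟩ := hV
    exact ⟨neg x, by rwa [filtersAt_neg], by rw [filtersAt_neg]⟩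
  | univ => exact ⟨top, F.top_mem, Set.subset_univ _⟩
  | inter V W _ _ ihV ihW =>
    obtain ⟨a, ha, haV⟩ := ihV hF.1
    obtain ⟨b, hb, hbW⟩ := ihW hF.2
    refine ⟨a ⊓ₔ b, F.meet_mem_iff.2 ⟨ha, hb⟩, ?_⟩
    rw [filtersAt_meet]
    exact Set.inter_subset_inter haV hbW
  | sUnion S _ ih =>
    obtain ⟨V, hVS, hFV⟩ := hF
    obtain ⟨a, ha, haV⟩ := ih V hVS hFV
    exact ⟨a, ha, haV.trans (Set.subset_sUnion_of_mem hVS)⟩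

theorem filtersAt_sup (a b : MeetPart D) :
    filtersAt (a ⊔ b).1 = filtersAt a.1 ∪ filtersAt b.1 := by
  change filtersAt (neg (neg a.1 ⊓ₔ neg b.1)) = _
  rw [filtersAt_neg, filtersAt_meet, filtersAt_neg, filtersAt_neg, Set.compl_inter, compl_compl,
    compl_compl]

/-- The ideal of the elements of the meet part whose set of primary filters lies in `A`. -/
def subsetIdeal (A : Set (PrimaryFilter D)) : Order.Ideal (MeetPart D) where
  carrier := {a | filtersAt a.1 ⊆ A}
  lower' _ _ hba ha := fun F hF => ha (F.mem_of_le hba hF)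
  nonempty' := ⟨⊥, by
    change filtersAt bot ⊆ A
    rw [filtersAt_bot]
    exact Set.empty_subset A⟩
  directed' a ha b hb := by
    refine ⟨a ⊔ b, ?_, le_sup_left, le_sup_right⟩
    change filtersAt (a ⊔ b).1 ⊆ A
    rw [filtersAt_sup]
    exact Set.union_subset ha hb

/-- Compactness in ideal form. If `⊤` is a join of some `a` with `F_a ⊆ A` and some `b` with `F_b ⊆
Aᶜ`, then `F_a` is all of `A`. -/
theorem exists_eq_filtersAt_of_isClopen {A : Set (PrimaryFilter D)} (hA : IsClopen A) :
    ∃ a : D, a ⊓ₔ a = a ∧ A = filtersAt a := by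
  -- Otherwise some primary filter `F` avoids both ideals; but `F` lies in `A` or `Aᶜ`, both open,
  -- and a basic neighbourhood of `F` there gives an element of `F` in one of the ideals.
  have htop : (⊤ : MeetPart D) ∈ subsetIdeal A ⊔ subsetIdeal Aᶜ := by
    by_contra hn
    obtain ⟨F, -, hF⟩ := PrimaryFilter.exists_of_notMem_ideal hn
    have key : ∀ U : Set (PrimaryFilter D), IsOpen U → F ∈ U →
        subsetIdeal U ≤ subsetIdeal A ⊔ subsetIdeal Aᶜ → False := by
      intro U hU hFU hle
      obtain ⟨a, ha, haU⟩ := exists_filtersAt_subset_of_isOpen hU hFU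
      refine hF (meetSelf a) (hle ?_) (F.meet_self_mem_iff.2 ha)
      change filtersAt (a ⊓ₔ a) ⊆ U
      rwa [filtersAt_meet_self]
    by_cases h : F ∈ A
    · exact key A hA.isOpen h le_sup_left
    · exact key Aᶜ hA.compl.isOpen h le_sup_right
  obtain ⟨a, ha, b, hb, hab⟩ := Order.Ideal.mem_sup.1 htop
  refine ⟨a.1, a.2, Set.Subset.antisymm (fun F hF => ?_) ha⟩
  have : F ∈ filtersAt (a ⊔ b).1 := F.mem_of_le hab (F.meet_self_mem_iff.2 F.top_mem)
  rw [filtersAt_sup] at this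
  exact this.resolve_right fun hFb => hb hFb hF

/-- If `I` misses `x`, separating `x` from the trace of `I` gives a primary filter through `x`
disjoint from `I`: a common element `z` would put `z ⊓ z` in both. -/
theorem upperPolar_filtersAt {x : D} (hx : x ⊓ₔ x = x) :
    upperPolar (Delta D) (filtersAt x) = idealsAt x := by
  refine Set.Subset.antisymm (fun I hI => ?_) fun I hI F hF => ⟨x, hF, hI⟩
  by_contra hn
  obtain ⟨F, hxF, hF⟩ := PrimaryFilter.exists_of_notMem_ideal (a := ⟨x, hx⟩)
    (J := idealTrace I.carrier I.isIdeal I.nonempty) hn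
  obtain ⟨z, hzF, hzI⟩ := hI hxF
  exact hF (meetSelf z) (I.isIdeal.2 _ hzI _ (meet_le_left z z)) (F.meet_self_mem_iff.2 hzF)

end Filters

/-! ### Primary ideals, by duality. -/

section Dual

/-- The dual of an algebra of type `(2,2,1,1,0,0)`. -/
def DBDual (D : Type*) : Type _ := D

variable {D : Type*} [DBOps D]

instance : DBOps (DBDual D) where
  meet := join (D := D)
  join := meet (D := D)
  neg := opp (D := D)
  opp := neg (D := D)
  top := bot (D := D)
  bot := top (D := D)

instance [DoubleBooleanAlgebra D] : DoubleBooleanAlgebra (DBDual D) where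
  ax1a := ax1b (D := D)
  ax1b := ax1a (D := D)
  ax2a := ax2b (D := D)
  ax2b := ax2a (D := D)
  ax3a := ax3b (D := D)
  ax3b := ax3a (D := D)
  ax4a := ax4b (D := D)
  ax4b := ax4a (D := D)
  ax5a := ax5b (D := D)
  ax5b := ax5a (D := D)
  ax6a := ax6b (D := D)
  ax6b := ax6a (D := D)
  ax7a := ax7b (D := D)
  ax7b := ax7a (D := D)
  ax8a := ax8b (D := D)
  ax8b := ax8a (D := D)
  ax9a := ax9b (D := D)
  ax9b := ax9a (D := D)
  ax10a := ax10b (D := D)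
  ax10b := ax10a (D := D)
  ax11a := ax11b (D := D)
  ax11b := ax11a (D := D)
  ax12 x := (ax12 (D := D) x).symm

variable [DoubleBooleanAlgebra D]

theorem le_dual_iff {x y : D} : le (D := DBDual D) x y ↔ le y x := by
  change x ⊔ₔ y = x ⊔ₔ x ∧ x ⊓ₔ y = y ⊓ₔ y ↔ y ⊓ₔ x = y ⊓ₔ y ∧ y ⊔ₔ x = x ⊔ₔ x
  rw [ax2b x y, ax2a x y, and_comm]

/-- A primary ideal as a primary filter of the dual. -/
def PrimaryIdeal.toDual (I : PrimaryIdeal D) : PrimaryFilter (DBDual D) where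
  carrier := I.carrier
  isFilter := ⟨I.isIdeal.1, fun x hx z h => I.isIdeal.2 x hx z (le_dual_iff.1 h)⟩
  nonempty := I.nonempty
  proper := I.proper
  primary := I.primary

/-- A primary filter of the dual as a primary ideal. -/
def PrimaryFilter.ofDual (F : PrimaryFilter (DBDual D)) : PrimaryIdeal D where
  carrier := F.carrier
  isIdeal := ⟨F.isFilter.1, fun x hx z h => F.isFilter.2 x hx z (le_dual_iff.2 h)⟩
  nonempty := F.nonempty
  proper := F.proper
  primary := F.primary

/-- A primary filter as a primary ideal of the dual. -/
def PrimaryFilter.toDual (F : PrimaryFilter D) : PrimaryIdeal (DBDual D) where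
  carrier := F.carrier
  isIdeal := ⟨F.isFilter.1, fun x hx z h => F.isFilter.2 x hx z (le_dual_iff.1 h)⟩
  nonempty := F.nonempty
  proper := F.proper
  primary := F.primary

theorem PrimaryFilter.continuous_ofDual :
    Continuous (PrimaryFilter.ofDual : PrimaryFilter (DBDual D) → PrimaryIdeal D) := by
  refine continuous_generateFrom_iff.2 ?_
  rintro _ ⟨x, rfl⟩
  exact TopologicalSpace.isOpen_generateFrom_of_mem ⟨x, rfl⟩

theorem idealsAt_join (x y : D) : idealsAt (x ⊔ₔ y) = idealsAt x ∩ idealsAt y :=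
  Set.ext fun I => I.toDual.meet_mem_iff

theorem idealsAt_join_self (x : D) : idealsAt (x ⊔ₔ x) = idealsAt x := by
  rw [idealsAt_join, Set.inter_self]

theorem idealsAt_opp (x : D) : idealsAt (opp x) = (idealsAt x)ᶜ :=
  Set.ext fun I => I.toDual.neg_mem_iff

theorem idealsAt_bot : idealsAt (bot : D) = Set.univ :=
  Set.eq_univ_of_forall fun I => I.toDual.top_mem

theorem idealsAt_top : idealsAt (top : D) = ∅ :=
  Set.eq_empty_of_forall_notMem fun I => I.toDual.bot_notMem

theorem isClopen_idealsAt (x : D) : IsClopen (idealsAt x) := by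
  refine ⟨⟨TopologicalSpace.isOpen_generateFrom_of_mem ⟨x, rfl⟩⟩, ?_⟩
  refine TopologicalSpace.isOpen_generateFrom_of_mem ⟨opp x, ?_⟩
  rw [idealsAt_opp, compl_compl]

theorem join_self_eq_of_idealsAt_eq {x y : D} (h : idealsAt x = idealsAt y) :
    x ⊔ₔ x = y ⊔ₔ y :=
  meet_self_eq_of_filtersAt_eq (D := DBDual D) (x := x) (y := y)
    -- The preimage of `I_x` under `PrimaryFilter.ofDual` is by definition the set `F_x` of the dual
    -- algebra.
    (congrArg (PrimaryFilter.ofDual ⁻¹' ·) h)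

theorem exists_eq_idealsAt_of_isClopen {B : Set (PrimaryIdeal D)} (hB : IsClopen B) :
    ∃ b : D, b ⊔ₔ b = b ∧ B = idealsAt b := by
  obtain ⟨b, hb, h⟩ :=
    exists_eq_filtersAt_of_isClopen (hB.preimage PrimaryFilter.continuous_ofDual)
  exact ⟨b, hb, congrArg (PrimaryIdeal.toDual ⁻¹' ·) h⟩

theorem lowerPolar_idealsAt {x : D} (hx : x ⊔ₔ x = x) :
    lowerPolar (Delta D) (idealsAt x) = filtersAt x := by
  have h := upperPolar_filtersAt (D := DBDual D) (x := x) hx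
  ext F
  -- Passing to the dual only swaps the two sides of the intersection that defines `Delta`.
  refine Iff.trans ⟨fun hF J hJ => ?_, fun hF I hI => ?_⟩ (Set.ext_iff.1 h F.toDual)
  · obtain ⟨z, hz⟩ := hF (b := J.ofDual) hJ
    exact ⟨z, hz.2, hz.1⟩
  · obtain ⟨z, hz⟩ := hF (a := I.toDual) hI
    exact ⟨z, hz.2, hz.1⟩

end Dual

/-! ### Transport of identities and properties along isomorphisms. -/

section Transport

variable {D E : Type*} [DBOps D] [DBOps E]

theorem DBOps.Iso.doubleBooleanAlgebra [DoubleBooleanAlgebra D] (e : Iso D E) :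
    DoubleBooleanAlgebra E := by
  have hs : Function.Surjective e.toFun := e.toEquiv.surjective
  constructor
  -- The alternatives run from three variables down to none, so that each identity is pulled back in
  -- all its variables.
  all_goals first
    | (refine hs.forall₃.2 fun x y z => ?_
       simp only [vee, wedge, ← e.map_meet, ← e.map_join, ← e.map_neg, ← e.map_opp])
    | (refine hs.forall₂.2 fun x y => ?_
       simp only [vee, wedge, ← e.map_meet, ← e.map_join, ← e.map_neg, ← e.map_opp])
    | (refine hs.forall.2 fun x => ?_
       simp only [← e.map_meet, ← e.map_join, ← e.map_neg, ← e.map_opp, ← e.map_top, ← e.map_bot])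
    | simp only [← e.map_meet, ← e.map_join, ← e.map_neg, ← e.map_opp, ← e.map_top, ← e.map_bot]
  all_goals refine congrArg e.toFun ?_
  exacts [ax1a x y, ax1b x y, ax2a x y, ax2b x y, ax3a x, ax3b x, ax4a x y, ax4b x y, ax5a x y z,
    ax5b x y z, ax6a x y, ax6b x y, ax7a x y, ax7b x y, ax8a x, ax8b x, ax9a, ax9b, ax10a x y z,
    ax10b x y z, ax11a, ax11b, ax12 x]

theorem DBOps.Iso.le_iff (e : Iso D E) (x y : D) : le (e.toFun x) (e.toFun y) ↔ le x y := by
  have hi : Function.Injective e.toFun := e.toEquiv.injective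
  simp only [le, ← e.map_meet, ← e.map_join, hi.eq_iff]

theorem DBOps.Iso.contextual (e : Iso D E) (h : Contextual D) : Contextual E := by
  have hs : Function.Surjective e.toFun := e.toEquiv.surjective
  have : IsPartialOrder D (le : D → D → Prop) := h
  refine { refl := ?_, trans := ?_, antisymm := ?_ }
  · exact hs.forall.2 fun x => (e.le_iff x x).2 (refl_of le x)
  · refine hs.forall₃.2 fun x y z => ?_
    simp only [e.le_iff]
    exact trans_of le
  · refine hs.forall₂.2 fun x y => ?_
    simp only [e.le_iff]
    exact fun hxy hyx => congrArg e.toFun (antisymm_of le hxy hyx)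

theorem DBOps.Iso.fullyContextual (e : Iso D E) (h : FullyContextual D) : FullyContextual E := by
  have hs : Function.Surjective e.toFun := e.toEquiv.surjective
  have hi : Function.Injective e.toFun := e.toEquiv.injective
  refine ⟨e.contextual h.1, hs.forall₂.2 fun y x => ?_⟩
  simp only [← e.map_meet, ← e.map_join, hi.eq_iff]
  intro hy hx hyx
  obtain ⟨z, hz, hu⟩ := h.2 y x hy hx hyx
  refine ⟨e.toFun z, ?_, hs.forall.2 fun w => ?_⟩
  · simpa only [← e.map_meet, ← e.map_join, hi.eq_iff] using hz
  · simp only [← e.map_meet, ← e.map_join, hi.eq_iff]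
    exact hu w

theorem DBOps.Iso.pure (e : Iso D E) (h : Pure D) : Pure E := by
  have hs : Function.Surjective e.toFun := e.toEquiv.surjective
  have hi : Function.Injective e.toFun := e.toEquiv.injective
  refine hs.forall.2 fun x => ?_
  simpa only [← e.map_meet, ← e.map_join, hi.eq_iff] using h x

end Transport

/-! ### The representation `x ↦ (F_x, I_x)`. -/

section Representation

variable {D : Type*} [DBOps D] [DoubleBooleanAlgebra D]

/-- The pair `(F_x, I_x)`. -/
def representation (x : D) : Set (PrimaryFilter D) × Set (PrimaryIdeal D) :=
  (filtersAt x, idealsAt x)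

theorem representation_of_meet_self {x : D} (hx : x ⊓ₔ x = x) :
    representation x = (filtersAt x, upperPolar (Delta D) (filtersAt x)) := by
  rw [upperPolar_filtersAt hx, representation]

theorem representation_of_join_self {x : D} (hx : x ⊔ₔ x = x) :
    representation x = (lowerPolar (Delta D) (idealsAt x), idealsAt x) := by
  rw [lowerPolar_idealsAt hx, representation]

theorem representation_meet (x y : D) :
    representation (x ⊓ₔ y) = pairMeet (Delta D) (representation x) (representation y) := by
  rw [representation_of_meet_self (meet_idem x y), filtersAt_meet]
  rfl

theorem representation_join (x y : D) :
    representation (x ⊔ₔ y) = pairJoin (Delta D) (representation x) (representation y) := by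
  rw [representation_of_join_self (join_idem x y), idealsAt_join]
  rfl

theorem representation_neg (x : D) :
    representation (neg x) = pairNeg (Delta D) (representation x) := by
  rw [representation_of_meet_self (neg_meet_neg x), filtersAt_neg]
  rfl

theorem representation_opp (x : D) :
    representation (opp x) = pairOpp (Delta D) (representation x) := by
  rw [representation_of_join_self (opp_join_opp x), idealsAt_opp]
  rfl

theorem representation_top : representation (top : D) = (Set.univ, ∅) := by
  rw [representation, filtersAt_top, idealsAt_top]

theorem representation_bot : representation (bot : D) = (∅, Set.univ) := by
  rw [representation, filtersAt_bot, idealsAt_bot]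

theorem closedUnderPairOps_of_forall_mem_iff
    {S : Set (Set (PrimaryFilter D) × Set (PrimaryIdeal D))}
    (hS : ∀ p, p ∈ S ↔ ∃ x : D, representation x = p) : ClosedUnderPairOps (Delta D) S where
  meet_mem p hp q hq := by
    obtain ⟨x, rfl⟩ := (hS p).1 hp
    obtain ⟨y, rfl⟩ := (hS q).1 hq
    exact (hS _).2 ⟨_, representation_meet x y⟩
  join_mem p hp q hq := by
    obtain ⟨x, rfl⟩ := (hS p).1 hp
    obtain ⟨y, rfl⟩ := (hS q).1 hq
    exact (hS _).2 ⟨_, representation_join x y⟩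
  neg_mem p hp := by
    obtain ⟨x, rfl⟩ := (hS p).1 hp
    exact (hS _).2 ⟨_, representation_neg x⟩
  opp_mem p hp := by
    obtain ⟨x, rfl⟩ := (hS p).1 hp
    exact (hS _).2 ⟨_, representation_opp x⟩
  top_mem := (hS _).2 ⟨_, representation_top⟩
  bot_mem := (hS _).2 ⟨_, representation_bot⟩

theorem exists_iso_of_forall_mem_iff
    {S : Set (Set (PrimaryFilter D) × Set (PrimaryIdeal D))}
    (hS : ∀ p, p ∈ S ↔ ∃ x : D, representation x = p)
    (hinj : Function.Injective (representation (D := D))) (h : ClosedUnderPairOps (Delta D) S) :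
    letI : DBOps S := h.ops
    ∃ e : Iso D S, ∀ x : D, (e.toFun x).1 = (filtersAt x, idealsAt x) := by
  let _ : DBOps S := h.ops
  let f : D → S := fun x => ⟨representation x, (hS _).2 ⟨x, rfl⟩⟩
  have hf : Function.Bijective f := by
    refine ⟨fun x y hxy => hinj (congrArg Subtype.val hxy), fun p => ?_⟩
    obtain ⟨x, hx⟩ := (hS p.1).1 p.2
    exact ⟨x, Subtype.ext hx⟩
  exact ⟨{ toEquiv := Equiv.ofBijective f hf
           map_meet := fun x y => Subtype.ext (representation_meet x y)
           map_join := fun x y => Subtype.ext (representation_join x y)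
           map_neg := fun x => Subtype.ext (representation_neg x)
           map_opp := fun x => Subtype.ext (representation_opp x)
           map_top := Subtype.ext representation_top
           map_bot := Subtype.ext representation_bot }, fun x => rfl⟩

/-- Since `I_a = I_{a ⊔ a}`, the double polar of `F_a` is `F_{a ⊔ a}`, to be compared with `I_b' =
F_b`. By `ax12`, `a ⊔ a` is `⊓`-idempotent, so equality of these sets says `a ⊔ a = b ⊓ b`. -/
theorem isProtoconcept_filtersAt_idealsAt_iff {a b : D} (ha : a ⊓ₔ a = a) (hb : b ⊔ₔ b = b) :
    IsProtoconcept (Delta D) (filtersAt a) (idealsAt b) ↔ a ⊔ₔ a = b ⊓ₔ b := by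
  have h1 : (a ⊔ₔ a) ⊓ₔ (a ⊔ₔ a) = a ⊔ₔ a := by
    rw [← ax12, ha]
  rw [IsProtoconcept, upperPolar_filtersAt ha, ← idealsAt_join_self a,
    lowerPolar_idealsAt (join_idem a a), lowerPolar_idealsAt hb]
  refine ⟨fun h => ?_, fun h => ?_⟩
  · rw [← h1, meet_self_eq_of_filtersAt_eq h]
  · rw [h, filtersAt_meet_self]

theorem isProtoconcept_filtersAt_idealsAt (x : D) :
    IsProtoconcept (Delta D) (filtersAt x) (idealsAt x) := by
  rw [← filtersAt_meet_self, ← idealsAt_join_self,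
    isProtoconcept_filtersAt_idealsAt_iff (meet_idem x x) (join_idem x x)]
  -- For `a = x ⊓ x` and `b = x ⊔ x`, the protoconcept criterion is `ax12` itself.
  exact ax12 x

theorem DBOps.FullyContextual.mem_clopenProtoconcepts_iff (hD : FullyContextual D)
    (p : Set (PrimaryFilter D) × Set (PrimaryIdeal D)) :
    p ∈ clopenProtoconcepts (Delta D) ↔ ∃ x : D, representation x = p := by
  refine ⟨?_, ?_⟩
  · obtain ⟨A, B⟩ := p
    rintro ⟨hp, hA, hB⟩
    obtain ⟨a, ha, rfl⟩ := exists_eq_filtersAt_of_isClopen hA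
    obtain ⟨b, hb, rfl⟩ := exists_eq_idealsAt_of_isClopen hB
    obtain ⟨z, ⟨rfl, rfl⟩, -⟩ :=
      hD.2 a b ha hb ((isProtoconcept_filtersAt_idealsAt_iff ha hb).1 hp)
    exact ⟨z, by rw [representation, filtersAt_meet_self, idealsAt_join_self]⟩
  · rintro ⟨x, rfl⟩
    exact ⟨isProtoconcept_filtersAt_idealsAt x, isClopen_filtersAt x, isClopen_idealsAt x⟩

theorem DBOps.Pure.mem_clopenSemiconcepts_iff (hD : Pure D)
    (p : Set (PrimaryFilter D) × Set (PrimaryIdeal D)) :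
    p ∈ clopenSemiconcepts (Delta D) ↔ ∃ x : D, representation x = p := by
  refine ⟨?_, ?_⟩
  · obtain ⟨A, B⟩ := p
    rintro ⟨hp | hp, hA, hB⟩
    · obtain ⟨a, ha, rfl⟩ := exists_eq_filtersAt_of_isClopen hA
      exact ⟨a, by rw [representation_of_meet_self ha]; exact congrArg _ hp⟩
    · obtain ⟨b, hb, rfl⟩ := exists_eq_idealsAt_of_isClopen hB
      exact ⟨b, by rw [representation_of_join_self hb]; exact congrArg (·, _) hp⟩
  · rintro ⟨x, rfl⟩
    refine ⟨?_, isClopen_filtersAt x, isClopen_idealsAt x⟩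
    exact (hD x).imp upperPolar_filtersAt lowerPolar_idealsAt

theorem meet_self_eq_and_join_self_eq_of_representation_eq {x y : D}
    (h : representation x = representation y) : x ⊓ₔ x = y ⊓ₔ y ∧ x ⊔ₔ x = y ⊔ₔ y :=
  ⟨meet_self_eq_of_filtersAt_eq (congrArg Prod.fst h),
    join_self_eq_of_idealsAt_eq (congrArg Prod.snd h)⟩

theorem le_of_meet_self_eq_of_join_self_eq {x y : D} (h1 : x ⊓ₔ x = y ⊓ₔ y)
    (h2 : x ⊔ₔ x = y ⊔ₔ y) : le x y :=
  ⟨by rw [← ax1a, h1, ax1a], by rw [← ax1b, h2, ax1b]⟩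

theorem DBOps.Contextual.representation_injective (hD : Contextual D) :
    Function.Injective (representation (D := D)) := fun x y h => by
  have : IsPartialOrder D (le : D → D → Prop) := hD
  obtain ⟨h1, h2⟩ := meet_self_eq_and_join_self_eq_of_representation_eq h
  exact antisymm_of le (le_of_meet_self_eq_of_join_self_eq h1 h2)
    (le_of_meet_self_eq_of_join_self_eq h1.symm h2.symm)

/-- The mixed case of injectivity for pure algebras: under these equations `ax12` for `x` collapses
to `y = x`. -/
theorem eq_of_meet_self_of_join_self {x y : D} (hx : x ⊓ₔ x = x) (hy : y ⊔ₔ y = y)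
    (h1 : x ⊓ₔ x = y ⊓ₔ y) (h2 : x ⊔ₔ x = y ⊔ₔ y) : x = y := by
  have h := ax12 x
  rw [hx, h2, hy, ← h1, hx] at h
  exact h.symm

theorem DBOps.Pure.representation_injective (hD : Pure D) :
    Function.Injective (representation (D := D)) := fun x y h => by
  obtain ⟨h1, h2⟩ := meet_self_eq_and_join_self_eq_of_representation_eq h
  rcases hD x with hx | hx <;> rcases hD y with hy | hy
  · rw [← hx, h1, hy]
  · exact eq_of_meet_self_of_join_self hx hy h1 h2
  · exact (eq_of_meet_self_of_join_self hy hx h1.symm h2.symm).symm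
  · rw [← hx, h2, hy]

end Representation

theorem mainTheorem4 (D : Type*) [DBOps D] [DoubleBooleanAlgebra D] :
    (DBOps.FullyContextual D →
      (∀ (A : Set (PrimaryFilter D)) (B : Set (PrimaryIdeal D)),
        (A, B) ∈ clopenProtoconcepts (Delta D) ↔ ∃ x : D, A = filtersAt x ∧ B = idealsAt x) ∧
      ∃ h : ClosedUnderPairOps (Delta D) (clopenProtoconcepts (Delta D)),
        letI : DBOps (clopenProtoconcepts (Delta D)) := h.ops
        DoubleBooleanAlgebra (clopenProtoconcepts (Delta D)) ∧
        DBOps.FullyContextual (clopenProtoconcepts (Delta D)) ∧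
        ∃ e : DBOps.Iso D (clopenProtoconcepts (Delta D)),
          ∀ x : D, (e.toFun x).1 = (filtersAt x, idealsAt x)) ∧
    (DBOps.Pure D →
      (∀ (A : Set (PrimaryFilter D)) (B : Set (PrimaryIdeal D)),
        (A, B) ∈ clopenSemiconcepts (Delta D) ↔ ∃ x : D, A = filtersAt x ∧ B = idealsAt x) ∧
      ∃ h : ClosedUnderPairOps (Delta D) (clopenSemiconcepts (Delta D)),
        letI : DBOps (clopenSemiconcepts (Delta D)) := h.ops
        DoubleBooleanAlgebra (clopenSemiconcepts (Delta D)) ∧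
        DBOps.Pure (clopenSemiconcepts (Delta D)) ∧
        ∃ e : DBOps.Iso D (clopenSemiconcepts (Delta D)),
          ∀ x : D, (e.toFun x).1 = (filtersAt x, idealsAt x)) := by
  have hpair : ∀ (A : Set (PrimaryFilter D)) (B : Set (PrimaryIdeal D)),
      (∃ x : D, representation x = (A, B)) ↔ ∃ x : D, A = filtersAt x ∧ B = idealsAt x :=
    fun A B => exists_congr fun x => by rw [representation, Prod.mk_inj, eq_comm, @eq_comm _ _ B]
  refine ⟨fun hD => ?_, fun hD => ?_⟩
  · have hS := hD.mem_clopenProtoconcepts_iff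
    have h := closedUnderPairOps_of_forall_mem_iff hS
    obtain ⟨e, he⟩ := exists_iso_of_forall_mem_iff hS hD.1.representation_injective h
    let _ : DBOps (clopenProtoconcepts (Delta D)) := h.ops
    exact ⟨fun A B => (hS _).trans (hpair A B), h, e.doubleBooleanAlgebra, e.fullyContextual hD,
      e, he⟩
  · have hS := hD.mem_clopenSemiconcepts_iff
    have h := closedUnderPairOps_of_forall_mem_iff hS
    obtain ⟨e, he⟩ := exists_iso_of_forall_mem_iff hS hD.representation_injective h
    let _ : DBOps (clopenSemiconcepts (Delta D)) := h.ops
    exact ⟨fun A B => (hS _).trans (hpair A B), h, e.doubleBooleanAlgebra, e.pure hD, e, he⟩
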